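/- **Game.** Fix $k\ge 0$, finite action sets $A^0,A^1$ of two players, a finite non-empty set $D$ of directions of Nature, and delay functions $\lambda^0,\lambda^1:D\to\{0,\dots,k\}$. Put $A=A^0\times A^1$ and $\Gamma=A\times D$ (moves). In each round both players choose actions and then Nature chooses a direction $d\in D$; histories are words in $\Gamma^*$, plays are sequences in $\Gamma^\omega$. Nature's direction $d$ in a round fixes the delay $\lambda^i(d)\le k$ after which the whole move of this round is revealed to player $i$: in every round, player $i$ observes exactly those moves, together with their age $j\in\{0,\dots,k\}$, that were made $j$ rounds ago and whose delay for $i$ is $j$. (For instance $D=E\times\{0,\dots,k\}^2$, where Nature chooses the two delays independently.) These observations are output by a finite Mealy machine $M^i$ that stores the last $k$ moves; $\tau\sim^i\tau'$ means that $M^i$ outputs the same observation sequence on the histories $\tau,\tau'$. The specification is a nondeterministic parity tree automaton $\mathcal W=(Q,\Delta,q_\varepsilon,\Omega)$ with $Q$ finite, $\Delta\subseteq Q\times A\times Q^D$ and $\Omega:Q\to\mathbb N$. **Strategies.** A decision structure $S$ consists of a (possibly infinite) set $V$ of nodes, an initial node, a transition function $V\times D\to V$ and a choice function $f:V\to A$.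 A history follows $S$ if each of its action profiles is the one prescribed by $f$ at the node reached so far. Write $v\approx^i v'$ if $v,v'$ are reached by histories $\tau\sim^i\tau'$ that follow $S$; $S$ is a strategy if $v\approx^i v'$ implies $f^i(v)=f^i(v')$ for both players $i$. It is winning if there is an accepting run of $\mathcal W$ on the tree of histories following $S$, that is, one for which, along every play through this tree, the least priority seen infinitely often is even. It is finite-state if $V$ is finite, and tree-shaped if every node is reached by exactly one word in $D^*$. A witness is a strategy $S$ with a labelling $\rho$ of its nodes by states of $M^0$, $M^1$ and $\mathcal W$ such that, along the histories that follow $S$, the labels describe the runs of the $M^i$ and an accepting run of $\mathcal W$. A d-state of a witness is a connected component of $\approx^0\cup\approx^1$ on $V$, with the structure (transitions, $\approx^0$, $\approx^1$, $\rho$) induced on it. **Theorem.** For every bound $k$ on the delay (in particular $k=3$): 1. In every tree-shaped witness all d-states are finite, of size at most $|\Gamma|^k$ (so at most $|\Gamma|^3$ for $k=3$), and there are only finitely many d-states up to isomorphism. 2. If there is a winning strategy, then there are a tree-shaped witness on the set of nodes $D^*$ and a finite-state winning strategy. -/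

import Mathlib

/-! Distributed games of a team against Nature: moves, observations by Mealy machines. -/

/-- A move `(a, d)`: an action profile of the team together with a direction of Nature.
Histories are finite lists of moves, plays are infinite sequences of moves. -/
abbrev Move {ι : Type*} (A : ι → Type*) (D : Type*) := (∀ i, A i) × D

/-- Mealy machines with states `Q`, reading letters of `Γ` and emitting letters of `B`. -/
structure Mealy (Γ B Q : Type*) where
  init : Q
  next : Q → Γ → Q
  out : Q → Γ → B

namespace Mealy

variable {Γ B Q : Type*} (M : Mealy Γ B Q)

/-- The state reached after reading `τ`. -/
def stateAfter (τ : List Γ) : Q := τ.foldl M.next M.init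

/-- The output sequence emitted while reading a word from the state `q`. -/
def outputFrom : Q → List Γ → List B
  | _, [] => []
  | q, α :: τ => M.out q α :: outputFrom (M.next q α) τ

/-- The output sequence on a history. -/
def output (τ : List Γ) : List B := M.outputFrom M.init τ

end Mealy

/-- A distributed game: each player `i` has a Mealy machine (with states `QM i` and observation
alphabet `B i`) that reads histories. -/
abbrev DistGame {ι : Type*} (A : ι → Type*) (D : Type*) (B QM : ι → Type*) :=
  ∀ i, Mealy (Move A D) (B i) (QM i)

/-- Histories `τ ∼ⁱ τ'` that player `i` cannot distinguish. -/
def DistGame.Indist {ι : Type*} {A : ι → Type*} {D : Type*} {B QM : ι → Type*}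
    (G : DistGame A D B QM) (i : ι) (τ τ' : List (Move A D)) : Prop :=
  (G i).output τ = (G i).output τ'

/-- Decision structures on the set `V` of nodes. -/
structure DecisionStructure {ι : Type*} (A : ι → Type*) (D V : Type*) where
  init : V
  next : V → D → V
  act : V → ∀ i, A i

namespace DecisionStructure

variable {ι : Type*} {A : ι → Type*} {D V : Type*} {B QM : ι → Type*}

/-- The node reached from the initial node along a word of directions. -/
def pathNode (S : DecisionStructure A D V) (w : List D) : V := w.foldl S.next S.init

/-- The end node of the trace of a history. -/
def node (S : DecisionStructure A D V) (τ : List (Move A D)) : V := S.pathNode (τ.map Prod.snd)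

/-- `τ` follows `S`: every action profile in `τ` is the one prescribed at the current node. -/
def Follows (S : DecisionStructure A D V) (τ : List (Move A D)) : Prop :=
  ∀ σ α, σ ++ [α] <+: τ → α.1 = S.act (S.node σ)

/-- The uniformity relation `v ≈ⁱ v'`: the two nodes are reached by indistinguishable histories
that follow `S`. -/
def Uniform (S : DecisionStructure A D V) (G : DistGame A D B QM) (i : ι) (v v' : V) : Prop :=
  ∃ τ τ', S.Follows τ ∧ S.Follows τ' ∧ G.Indist i τ τ' ∧ S.node τ = v ∧ S.node τ' = v'

/-- Strategy structures: uniformly related nodes prescribe the same action. -/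
def IsStrategy (S : DecisionStructure A D V) (G : DistGame A D B QM) : Prop :=
  ∀ i v v', S.Uniform G i v v' → S.act v i = S.act v' i

/-- `S` is a tree: every node is reached by exactly one word of directions. -/
def IsTree (S : DecisionStructure A D V) : Prop := Function.Bijective S.pathNode

end DecisionStructure

/-- Nondeterministic parity tree automata over trees with branching `D`, labelled by action
profiles. -/
structure TreeAutomaton {ι : Type*} (A : ι → Type*) (D Q : Type*) where
  init : Q
  trans : Set (Q × (∀ i, A i) × (D → Q))
  priority : Q → ℕ

/-- The least priority that appears infinitely often exists and is even. -/
def ParityCondition (c : ℕ → ℕ) : Prop :=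
  ∃ p, Even p ∧ IsLeast {m | ∃ᶠ n in Filter.atTop, c n = m} p

namespace TreeAutomaton

variable {ι : Type*} {A : ι → Type*} {D V Q : Type*} {B QM : ι → Type*}

/-- `r` is a run of `W` on the outcome of `S`; only the values of `r` at histories that follow `S`
matter. -/
def IsRun (W : TreeAutomaton A D Q) (S : DecisionStructure A D V) (r : List (Move A D) → Q) :
    Prop :=
  r [] = W.init ∧ ∀ τ, S.Follows τ →
    (r τ, S.act (S.node τ), fun d => r (τ ++ [(S.act (S.node τ), d)])) ∈ W.trans

/-- Every play through the outcome of `S` satisfies the parity condition under `r`. -/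
def IsAccepting (W : TreeAutomaton A D Q) (S : DecisionStructure A D V)
    (r : List (Move A D) → Q) : Prop :=
  ∀ π : ℕ → Move A D, (∀ n, S.Follows ((List.range n).map π)) →
    ParityCondition fun n => W.priority (r ((List.range n).map π))

end TreeAutomaton

namespace DecisionStructure

variable {ι : Type*} {A : ι → Type*} {D V Q : Type*} {B QM : ι → Type*}

/-- Winning strategies for the specification `W`. -/
def IsWinning (S : DecisionStructure A D V) (G : DistGame A D B QM) (W : TreeAutomaton A D Q) :
    Prop :=
  S.IsStrategy G ∧ ∃ r, W.IsRun S r ∧ W.IsAccepting S r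

/-- `(S, ρ)` is an annotated strategy: along every history that follows `S`, the labels `ρ` of the
nodes describe the runs of the Mealy machines and a run of `W`. -/
def IsAnnotated (S : DecisionStructure A D V) (G : DistGame A D B QM) (W : TreeAutomaton A D Q)
    (ρ : V → (∀ i, QM i) × Q) : Prop :=
  S.IsStrategy G ∧
  (∀ τ, S.Follows τ → ∀ i, (ρ (S.node τ)).1 i = (G i).stateAfter τ) ∧
  W.IsRun S fun τ => (ρ (S.node τ)).2

/-- `(S, ρ)` is a witness: an annotated strategy whose run of `W` is accepting. -/
def IsWitness (S : DecisionStructure A D V) (G : DistGame A D B QM) (W : TreeAutomaton A D Q)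
    (ρ : V → (∀ i, QM i) × Q) : Prop :=
  S.IsAnnotated G W ρ ∧ W.IsAccepting S fun τ => (ρ (S.node τ)).2

/-- The (node sets of) d-states: the connected components of the union of the relations `≈ⁱ`. -/
def IsDState (S : DecisionStructure A D V) (G : DistGame A D B QM) (K : Set V) : Prop :=
  ∃ v, K = {u | Relation.EqvGen (fun x y => ∃ i, S.Uniform G i x y) v u}

/-- Isomorphism of the substructures of `(V, E, (≈ⁱ), ρ)` induced by `K` and `L`. -/
def DStateIso (S : DecisionStructure A D V) (G : DistGame A D B QM)
    (ρ : V → (∀ i, QM i) × Q) (K L : Set V) : Prop :=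
  ∃ e : K ≃ L,
    (∀ (x y : K) (d : D), S.next x d = y ↔ S.next (e x) d = e y) ∧
    (∀ (i : ι) (x y : K), S.Uniform G i x y ↔ S.Uniform G i (e x) (e y)) ∧
    ∀ x : K, ρ (e x) = ρ x

/-- There are only finitely many d-states up to isomorphism. -/
def FiniteIndex (S : DecisionStructure A D V) (G : DistGame A D B QM)
    (ρ : V → (∀ i, QM i) × Q) : Prop :=
  ∃ F : Set (Set V), F.Finite ∧ (∀ L ∈ F, S.IsDState G L) ∧
    ∀ K, S.IsDState G K → ∃ L ∈ F, S.DStateIso G ρ K L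

end DecisionStructure

/-- The game of perfect information with observation delays bounded by `k`. The direction that
Nature chooses in a round fixes, for every player `i`, the delay `lag d i ≤ k` after which the
move of this round is revealed to `i`. The Mealy machine of player `i` stores the last `k` moves
(slot `j` holds the move made `j + 1` rounds ago); in each round it emits, for every age
`j = 0, …, k`, the move made `j` rounds ago if the delay of that move for player `i` is exactly
`j`, and `none` otherwise. -/
def delayGame {ι : Type*} {A : ι → Type*} {D : Type*} (k : ℕ) (lag : D → ι → Fin (k + 1)) :
    DistGame A D (fun _ => Fin (k + 1) → Option (Move A D))
      (fun _ => Fin k → Option (Move A D)) :=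
  fun i =>
    { init := fun _ => none
      next := fun q α j => (Fin.cons (some α) q : Fin (k + 1) → Option (Move A D)) j.castSucc
      out := fun q α j =>
        ((Fin.cons (some α) q : Fin (k + 1) → Option (Move A D)) j).filter
          fun m => decide (lag m.2 i = j) }

-- A delay of at most `k` makes uncertainty local. Indistinguishable histories coincide except in
-- their last `k` moves (`AgreeRevealed.take_eq`), and whether two continuations of equal length of
-- a common stem can be told apart does not depend on the stem (`AgreeRevealed.replace_stem`).
--
-- In a tree, a d-state therefore consists of nodes of one depth that lie at most `k` rounds below a
-- common stem. Read relative to that stem, it is described by finitely many data, which gives the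
-- size bound and the finite index.
--
-- A winning strategy unfolds to a tree witness on the words over `D`, since the directions
-- determine the history that follows it. For a finite-state strategy, these words are classified by
-- the state of the automaton and the actions at all nodes at most `k` rounds below. After each
-- round the play jumps to a representative of the class reached. The last `k` rounds then look like
-- rounds of the original strategy below one representative, so replacing the stem yields uniformity
-- (`isStrategy_quotientStructure`).
--
-- Acceptance requires well-chosen representatives. Each takes the least signature in its class: a
-- lexicographic vector of ordinals, lower priorities first, whose coordinate at an odd `p` ranks
-- the visits to `p` still possible before a lower priority. If an odd `p` were the least priority
-- seen infinitely often, the signature truncated at `p` would eventually never increase, yet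
-- decrease infinitely often (`exists_representatives`).

universe u

/-! ### Parity games: signatures -/

/-- `x` has a path of length `n` along `E` to a point of `T`, with all points before the last one
in `P`. -/
inductive ReachesIn {X : Type*} (E : X → X → Prop) (P T : X → Prop) : ℕ → X → Prop
  | here {x : X} : T x → ReachesIn E P T 0 x
  | step {n : ℕ} {x y : X} : P x → E x y → ReachesIn E P T n y → ReachesIn E P T (n + 1) x

theorem exists_reachesIn {X : Type*} {E : X → X → Prop} {P T : X → Prop} {x w : X}
    (h : Relation.ReflTransGen (fun a b => E a b ∧ P a) x w) (hw : T w) :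
    ∃ n, ReachesIn E P T n x := by
  induction h using Relation.ReflTransGen.head_induction_on with
  | refl => exact ⟨0, .here hw⟩
  | head hab _ ih =>
    obtain ⟨n, hn⟩ := ih
    exact ⟨n + 1, .step hab.2 hab.1 hn⟩

/-- If from every point of `N` one can reach, through `P`, a point of `T` with a successor
in `N`, then some infinite path through `P` visits `T` infinitely often. -/
theorem exists_path_frequently {X : Type*} {E : X → X → Prop} {P T N : X → Prop}
    (hTP : ∀ x, T x → P x) (x₀ : X) (hx₀ : N x₀)
    (hN : ∀ x, N x → ∃ w z, Relation.ReflTransGen (fun a b => E a b ∧ P a) x w ∧ T w ∧ E w z ∧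
      N z) :
    ∃ f : ℕ → X, (∀ n, E (f n) (f (n + 1))) ∧ (∀ n, P (f n)) ∧ ∃ᶠ n in Filter.atTop, T (f n) := by
  set T' : X → Prop := fun w => T w ∧ ∃ z, E w z ∧ N z
  have hstart : ∀ x, N x → ∃ n, ReachesIn E P T' n x := by
    intro x hx
    obtain ⟨w, z, hw, hT, hE, hz⟩ := hN x hx
    exact exists_reachesIn hw ⟨hT, z, hE, hz⟩
  -- A state is a point with a countdown to its next target. The countdown drops along each edge; at
  -- 0 the target is visited, and its successor in `N` starts a new one.
  have hnext : ∀ s : {s : ℕ × X // ReachesIn E P T' s.1 s.2},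
      ∃ t : {s : ℕ × X // ReachesIn E P T' s.1 s.2}, P s.1.2 ∧ E s.1.2 t.1.2 ∧
        (s.1.1 = 0 → T s.1.2) ∧ (s.1.1 ≠ 0 → t.1.1 + 1 = s.1.1) := by
    rintro ⟨⟨n, x⟩, h⟩
    cases h with
    | here h =>
      obtain ⟨hT, z, hE, hz⟩ := h
      obtain ⟨m, hm⟩ := hstart z hz
      exact ⟨⟨(m, z), hm⟩, hTP _ hT, hE, fun _ => hT, fun h => absurd rfl h⟩
    | @step m _ y hP hE hy =>
      exact ⟨⟨(m, y), hy⟩, hP, hE, fun h => absurd h (Nat.succ_ne_zero m), fun _ => rfl⟩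
  choose g hgP hgE hgT hgn using hnext
  obtain ⟨n₀, hn₀⟩ := hstart x₀ hx₀
  let s : ℕ → {s : ℕ × X // ReachesIn E P T' s.1 s.2} := fun n => g^[n] ⟨(n₀, x₀), hn₀⟩
  have hs : ∀ n, s (n + 1) = g (s n) := fun n => Function.iterate_succ_apply' g n _
  have hE : ∀ n, E (s n).1.2 (s (n + 1)).1.2 := fun n => by rw [hs]; exact hgE _
  refine ⟨fun n => (s n).1.2, hE, fun n => hgP _, ?_⟩
  rw [Filter.frequently_atTop]
  have key : ∀ m a, (s a).1.1 = m → ∃ b ≥ a, T (s b).1.2 := by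
    intro m
    induction m with
    | zero => exact fun a ha => ⟨a, le_rfl, hgT _ ha⟩
    | succ m ih =>
      intro a ha
      have h1 := hgn (s a) (by omega)
      rw [← hs] at h1
      obtain ⟨b, hb, hT⟩ := ih (a + 1) (by omega)
      exact ⟨b, by omega, hT⟩
  exact fun a => key _ a rfl

/-- `R z x` means that `z` directly follows a visit to priority `p` that is reachable from `x`
through priorities at least `p`. An infinite descending `R`-chain would splice into a forbidden
path, so `R` is well-founded and its rank serves. -/
theorem exists_rank {X : Type u} (E : X → X → Prop) (c : X → ℕ) (p : ℕ)
    (h : ¬ ∃ f : ℕ → X, (∀ n, E (f n) (f (n + 1))) ∧ (∀ n, p ≤ c (f n)) ∧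
      ∃ᶠ n in Filter.atTop, c (f n) = p) :
    ∃ r : X → Ordinal.{u}, ∀ x y, E x y → p ≤ c x → r y ≤ r x ∧ (c x = p → r y < r x) := by
  let R : X → X → Prop := fun z x => ∃ w,
    Relation.ReflTransGen (fun a b => E a b ∧ p ≤ c a) x w ∧ c w = p ∧ E w z
  have hwf : WellFounded R := by
    by_contra hR
    obtain ⟨x₀, hx₀⟩ : ∃ x, ¬ Acc R x := by
      by_contra! hacc
      exact hR ⟨hacc⟩
    refine h (exists_path_frequently (P := fun x => p ≤ c x) (T := fun x => c x = p)
      (N := fun x => ¬ Acc R x) (fun x hx => hx.ge) x₀ hx₀ ?_)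
    intro x hx
    obtain ⟨z, ⟨w, hw, hc, hE⟩, hz⟩ : ∃ z, R z x ∧ ¬ Acc R z := by
      by_contra! hacc
      exact hx ⟨x, hacc⟩
    exact ⟨w, z, hw, hc, hE, hz⟩
  have : IsWellFounded X R := ⟨hwf⟩
  refine ⟨IsWellFounded.rank R, fun x y hE hc => ⟨?_, fun hp => ?_⟩⟩
  -- Every `R`-predecessor of `y` is one of `x`, by prepending the edge.
  · rw [IsWellFounded.rank_eq R y]
    refine Ordinal.iSup_le ?_
    rintro ⟨z, w, hw, hcw, hz⟩
    exact Order.succ_le_of_lt (IsWellFounded.rank_lt_of_rel ⟨w, .head ⟨hE, hc⟩ hw, hcw, hz⟩)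
  · exact IsWellFounded.rank_lt_of_rel ⟨x, .refl, hp, hE⟩

theorem not_frequently_lt_of_eventually_le {α : Type*} [Preorder α] [WellFoundedLT α] (g : ℕ → α)
    (N : ℕ) (hle : ∀ n, N ≤ n → g (n + 1) ≤ g n) :
    ¬ ∃ᶠ n in Filter.atTop, g (n + 1) < g n := by
  intro hlt
  -- From a minimal value after `N` on, no further decrease is possible.
  obtain ⟨n₀, hn₀, hmin⟩ : ∃ n₀, N ≤ n₀ ∧ ∀ n, N ≤ n → ¬ g n < g n₀ := by
    obtain ⟨x, ⟨n₀, hn₀, rfl⟩, hx⟩ := (wellFounded_lt (α := α)).has_min (g '' Set.Ici N)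
      ⟨g N, N, Set.mem_Ici.2 le_rfl, rfl⟩
    exact ⟨n₀, hn₀, fun n hn => hx _ ⟨n, hn, rfl⟩⟩
  have hanti : ∀ n, n₀ ≤ n → g n ≤ g n₀ := by
    intro n hn
    induction n, hn using Nat.le_induction with
    | base => exact le_rfl
    | succ n hn ih => exact (hle n (hn₀.trans hn)).trans ih
  obtain ⟨n, hn, h⟩ := Filter.frequently_atTop.1 hlt n₀
  exact hmin (n + 1) (by omega) (h.trans_le (hanti n hn))

theorem exists_least_frequently (c : ℕ → ℕ) (m : ℕ) (hm : ∀ n, c n ≤ m) :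
    ∃ p, IsLeast {q | ∃ᶠ n in Filter.atTop, c n = q} p ∧ ∃ N, ∀ n, N ≤ n → p ≤ c n := by
  classical
  have hex : ∃ q, ∃ᶠ n in Filter.atTop, c n = q := by
    have hfin : (Set.range c).Finite := (Set.finite_Iic m).subset (by
      rintro _ ⟨n, rfl⟩
      exact hm n)
    by_contra! hno
    have : ∀ᶠ n in Filter.atTop, ∀ q ∈ Set.range c, c n ≠ q :=
      (Filter.eventually_all_finite hfin).2 fun q _ => hno q
    obtain ⟨n, hn⟩ := this.exists
    exact hn _ ⟨n, rfl⟩ rfl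
  refine ⟨Nat.find hex, ⟨Nat.find_spec hex, fun q hq => Nat.find_min' hex hq⟩, ?_⟩
  have : ∀ᶠ n in Filter.atTop, ∀ q ∈ Set.Iio (Nat.find hex), c n ≠ q :=
    (Filter.eventually_all_finite (Set.finite_Iio _)).2 fun q hq =>
      Filter.not_frequently.1 (Nat.find_min hex hq)
  obtain ⟨N, hN⟩ := Filter.eventually_atTop.1 this
  refine ⟨N, fun n hn => ?_⟩
  by_contra! hlt
  exact hN n hn _ hlt rfl

/-- A signature truncated at `p`. -/
def truncSignature {m : ℕ} (p : ℕ) (g : Fin (m + 1) → Ordinal) : Fin (m + 1) → Ordinal :=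
  fun j => if (j : ℕ) ≤ p then g j else 0

/-- Truncation keeps an initial segment of the coordinates: the first difference either survives or
is erased together with everything after it. Strictness may be lost. -/
theorem truncSignature_mono {m : ℕ} (p : ℕ) {g g' : Fin (m + 1) → Ordinal}
    (h : toLex g ≤ toLex g') :
    toLex (truncSignature p g) ≤ toLex (truncSignature p g') := by
  rcases h.lt_or_eq with h | h
  · obtain ⟨i, hi, hlt⟩ := h
    have hi' : ∀ j < i, g j = g' j := hi
    have hlt' : g i < g' i := hlt
    by_cases hip : (i : ℕ) ≤ p
    · have h1 : ∀ j < i, truncSignature p g j = truncSignature p g' j := fun j hj => by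
        simp [truncSignature, hi' j hj]
      have h2 : truncSignature p g i < truncSignature p g' i := by
        simpa [truncSignature, hip] using hlt'
      exact le_of_lt ⟨i, h1, h2⟩
    · refine le_of_eq (congrArg toLex (funext fun j => ?_))
      by_cases hj : (j : ℕ) ≤ p
      · simp [truncSignature, hi' j (Fin.lt_def.2 (by omega))]
      · simp [truncSignature, hj]
  · rw [toLex.injective h]

/-- If no infinite path violates the parity condition, then one can choose a representative in
each class of points such that the paths that jump to the representative after each step satisfy
the parity condition. -/
theorem exists_representatives {X : Type u} {C : Type*} [Nonempty X] (E : X → X → Prop) (c : X → ℕ) (m : ℕ)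
    (hm : ∀ x, c x ≤ m) (cls : X → C)
    (h : ∀ p, Odd p → ¬ ∃ f : ℕ → X, (∀ n, E (f n) (f (n + 1))) ∧ (∀ n, p ≤ c (f n)) ∧
      ∃ᶠ n in Filter.atTop, c (f n) = p) :
    ∃ rep : C → X, (∀ x, cls (rep (cls x)) = cls x) ∧
      ∀ (f : ℕ → X), (∀ n, ∃ y, E (f n) y ∧ f (n + 1) = rep (cls y)) →
        ParityCondition fun n => c (f n) := by
  classical
  choose! r hr using fun p (hp : Odd p) => exists_rank E c p (h p hp)
  -- Even coordinates carry no information and are set to 0.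
  let sig : X → Fin (m + 1) → Ordinal.{u} := fun x j => if Odd (j : ℕ) then r j x else 0
  have hrep : ∀ t : C, ∃ x, ∀ y, cls y = t → cls x = t ∧ toLex (sig x) ≤ toLex (sig y) := by
    intro t
    by_cases ht : ∃ y, cls y = t
    · obtain ⟨_, ⟨x, hx, rfl⟩, hmin⟩ :=
        (wellFounded_lt (α := Lex (Fin (m + 1) → Ordinal.{u}))).has_min
          ((fun x => toLex (sig x)) '' {y | cls y = t}) (Set.Nonempty.image _ ht)
      exact ⟨x, fun y hy => ⟨hx, not_lt.1 (hmin _ ⟨y, hy, rfl⟩)⟩⟩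
    · exact ⟨Classical.arbitrary X, fun y hy => absurd ⟨y, hy⟩ ht⟩
  choose rep hrep using hrep
  refine ⟨rep, fun x => (hrep _ x rfl).1, fun f hf => ?_⟩
  obtain ⟨p, hp, N, hN⟩ := exists_least_frequently (fun n => c (f n)) m fun n => hm _
  refine ⟨p, ?_, hp⟩
  by_contra hpe
  rw [Nat.not_even_iff_odd] at hpe
  have hpm : p ≤ m := by
    obtain ⟨n, hn⟩ := hp.1.exists
    exact hn ▸ hm _
  -- A coordinate `j ≤ p` is monotone along edges leaving priorities at least `j`, hence along those
  -- leaving priorities at least `p`.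
  have hcoord : ∀ x y, E x y → p ≤ c x → ∀ j,
      truncSignature p (sig y) j ≤ truncSignature p (sig x) j := by
    intro x y hE hc j
    by_cases hj : (j : ℕ) ≤ p
    · by_cases ho : Odd (j : ℕ)
      · simpa [truncSignature, sig, hj, ho] using (hr j ho x y hE (hj.trans hc)).1
      · simp [truncSignature, sig, ho]
    · simp [truncSignature, hj]
  let g : ℕ → Lex (Fin (m + 1) → Ordinal.{u}) := fun n => toLex (truncSignature p (sig (f n)))
  -- The representative has the least signature of its class, so the jump costs nothing.
  have hjump : ∀ n y, f (n + 1) = rep (cls y) →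
      g (n + 1) ≤ toLex (truncSignature p (sig y)) := by
    intro n y hy
    simp only [g, hy]
    exact truncSignature_mono p (hrep _ y rfl).2
  refine not_frequently_lt_of_eventually_le g N (fun n hn => ?_) (hp.1.mono fun n hn => ?_)
  · obtain ⟨y, hE, hy⟩ := hf n
    exact (hjump n y hy).trans (Pi.toLex_monotone (hcoord _ _ hE (hN n hn)))
  · obtain ⟨y, hE, hy⟩ := hf n
    refine (hjump n y hy).trans_lt (Pi.toLex_strictMono ?_)
    refine Pi.lt_def.2 ⟨hcoord _ _ hE (le_of_eq hn.symm), ⟨p, by omega⟩, ?_⟩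
    simpa [truncSignature, sig, hpe] using (hr p hpe _ y hE (le_of_eq hn.symm)).2 hn

/-! ### Observations with bounded delay -/

section Delay

variable {ι : Type*} {A : ι → Type*} {D : Type*}

theorem Mealy.outputFrom_append {Γ B Q : Type*} (M : Mealy Γ B Q) (q : Q) (τ σ : List Γ) :
    M.outputFrom q (τ ++ σ) = M.outputFrom q τ ++ M.outputFrom (τ.foldl M.next q) σ := by
  induction τ generalizing q with
  | nil => rfl
  | cons α τ ih => simp [Mealy.outputFrom, ih]

theorem Mealy.output_concat {Γ B Q : Type*} (M : Mealy Γ B Q) (τ : List Γ) (α : Γ) :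
    M.output (τ ++ [α]) = M.output τ ++ [M.out (M.stateAfter τ) α] :=
  M.outputFrom_append _ _ _

theorem Mealy.length_output {Γ B Q : Type*} (M : Mealy Γ B Q) (τ : List Γ) :
    (M.output τ).length = τ.length := by
  induction τ using List.reverseRecOn with
  | nil => rfl
  | append_singleton τ α ih => simp [Mealy.output_concat, ih]

/-- Two histories of the same length agree on all moves that have been revealed to `i`. -/
def AgreeRevealed {k : ℕ} (lag : D → ι → Fin (k + 1)) (i : ι) (τ τ' : List (Move A D)) : Prop :=
  τ.length = τ'.length ∧ ∀ (s : ℕ) (m m' : Move A D), τ.reverse[s]? = some m →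
    τ'.reverse[s]? = some m' → m = m' ∨ (s < lag m.2 i ∧ s < lag m'.2 i)

variable {k : ℕ} {lag : D → ι → Fin (k + 1)} {i : ι}

theorem delayGame_stateAfter (τ : List (Move A D)) (j : Fin k) :
    (delayGame (A := A) k lag i).stateAfter τ j = τ.reverse[(j : ℕ)]? := by
  induction τ using List.reverseRecOn generalizing j with
  | nil => rfl
  | append_singleton τ α ih =>
    have h : (delayGame (A := A) k lag i).stateAfter (τ ++ [α]) j =
        (Fin.cons (some α) ((delayGame (A := A) k lag i).stateAfter τ) :
          Fin (k + 1) → Option (Move A D)) j.castSucc := by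
      simp [Mealy.stateAfter, List.foldl_append, delayGame]
    rw [h]
    rcases j with ⟨j, hj⟩
    cases j with
    | zero => simp
    | succ j =>
      have : (⟨j + 1, hj⟩ : Fin k).castSucc = Fin.succ ⟨j, by omega⟩ := rfl
      rw [this, Fin.cons_succ, ih]
      simp

theorem delayGame_out (τ : List (Move A D)) (α : Move A D) (j : Fin (k + 1)) :
    (delayGame (A := A) k lag i).out ((delayGame (A := A) k lag i).stateAfter τ) α j =
      ((τ ++ [α]).reverse[(j : ℕ)]?).filter fun m => decide (lag m.2 i = j) := by
  have h : (Fin.cons (some α) ((delayGame (A := A) k lag i).stateAfter τ) :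
      Fin (k + 1) → Option (Move A D)) j = (τ ++ [α]).reverse[(j : ℕ)]? := by
    cases j using Fin.cases with
    | zero => simp
    | succ j => simp [delayGame_stateAfter]
  rw [← h]
  rfl

theorem AgreeRevealed.concat_left {τ τ' : List (Move A D)} {α α' : Move A D}
    (h : AgreeRevealed lag i (τ ++ [α]) (τ' ++ [α'])) : AgreeRevealed lag i τ τ' := by
  refine ⟨by simpa using h.1, fun s m m' hm hm' => ?_⟩
  have := h.2 (s + 1) m m' (by simpa using hm) (by simpa using hm')
  exact this.imp_right fun ⟨h1, h2⟩ => ⟨by omega, by omega⟩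

/-- Ages are counted from 0 at the last move. Each round reveals precisely the moves whose age
equals their delay, so the moves still hidden are those with age below the delay. -/
theorem delayGame_indist_iff (τ τ' : List (Move A D)) :
    (delayGame (A := A) k lag).Indist i τ τ' ↔ AgreeRevealed lag i τ τ' := by
  unfold DistGame.Indist
  induction τ using List.reverseRecOn generalizing τ' with
  | nil =>
    constructor
    · intro h
      have := congrArg List.length h
      rw [Mealy.length_output, Mealy.length_output] at this
      exact ⟨this, by simp⟩
    · intro h
      rw [List.length_eq_zero_iff.1 h.1.symm]
  | append_singleton τ α ih =>
    rcases List.eq_nil_or_concat' τ' with rfl | ⟨τ', α', rfl⟩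
    · constructor
      · intro h
        have := congrArg List.length h
        simp [Mealy.length_output] at this
      · intro h
        simpa using h.1
    rw [Mealy.output_concat, Mealy.output_concat, ← List.concat_eq_append, ← List.concat_eq_append,
      List.concat_inj, ih]
    constructor
    · rintro ⟨h, hout⟩
      refine ⟨by simpa using h.1, fun s m m' hm hm' => ?_⟩
      have hj : ∀ j : Fin (k + 1), (j : ℕ) = s →
          ((some m).filter fun m => decide (lag m.2 i = j)) =
            (some m').filter fun m => decide (lag m.2 i = j) := by
        rintro j rfl
        have := congrFun hout j
        rwa [delayGame_out, delayGame_out, hm, hm'] at this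
      -- One round earlier these moves had age `s - 1`, so the bound there is `s ≤ lag`; the new
      -- observation at age `s` then excludes equality for distinct moves.
      have h0 : m = m' ∨ (s ≤ lag m.2 i ∧ s ≤ lag m'.2 i) := by
        cases s with
        | zero => exact .inr ⟨Nat.zero_le _, Nat.zero_le _⟩
        | succ s => exact h.2 s m m' (by simpa using hm) (by simpa using hm')
      rcases h0 with rfl | ⟨h1, h2⟩
      · exact .inl rfl
      by_cases h3 : (lag m.2 i : ℕ) = s
      · have := hj _ h3
        rw [Option.filter_some_pos (by simp)] at this
        exact .inl (Option.some.inj (Option.filter_eq_some_iff.1 this.symm).1).symm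
      by_cases h4 : (lag m'.2 i : ℕ) = s
      · have := hj _ h4
        rw [Option.filter_some_pos (a := m') (by simp)] at this
        exact .inl (Option.some.inj (Option.filter_eq_some_iff.1 this).1)
      exact .inr ⟨by omega, by omega⟩
    · intro h
      refine ⟨h.concat_left, funext fun j => ?_⟩
      rw [delayGame_out, delayGame_out]
      have hlen : (τ ++ [α]).reverse.length = (τ' ++ [α']).reverse.length := by
        simpa using h.1
      by_cases hj : (j : ℕ) < (τ ++ [α]).reverse.length
      · have e := List.getElem?_eq_getElem hj
        have e' := List.getElem?_eq_getElem (hlen ▸ hj)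
        rw [e, e']
        rcases h.2 j _ _ e e' with h | ⟨h1, h2⟩
        · rw [h]
        · rw [Option.filter_some_neg, Option.filter_some_neg]
          · exact decide_eq_false fun h => h2.ne' (congrArg Fin.val h)
          · exact decide_eq_false fun h => h1.ne' (congrArg Fin.val h)
      · rw [List.getElem?_eq_none (by omega), List.getElem?_eq_none (by omega)]

/-- A move of age at least `k` cannot have a delay exceeding its age. -/
theorem AgreeRevealed.take_eq {τ τ' : List (Move A D)} (h : AgreeRevealed lag i τ τ') :
    τ.take (τ.length - k) = τ'.take (τ'.length - k) := by
  apply List.reverse_injective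
  rw [← List.drop_reverse, ← List.drop_reverse]
  refine List.ext_getElem (by simp [h.1]) fun s h1 h2 => ?_
  simp only [List.length_drop, List.length_reverse] at h1 h2
  rw [List.getElem_drop, List.getElem_drop]
  rcases h.2 (k + s) _ _ (List.getElem?_eq_getElem (by simpa using by omega))
    (List.getElem?_eq_getElem (by simpa using by omega)) with h | ⟨h1, _⟩
  · exact h
  · exact absurd h1 (by omega)

/-- Moves are compared by age, counted from the end: inside `w` and `w'` the stem is invisible, and
beyond them both histories show the same move of `ν`. -/
theorem AgreeRevealed.replace_stem {w w' σ : List (Move A D)} (hw : w.length = w'.length)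
    (h : AgreeRevealed lag i (σ ++ w) (σ ++ w')) (ν : List (Move A D)) :
    AgreeRevealed lag i (ν ++ w) (ν ++ w') := by
  refine ⟨by simp [hw], fun s m m' hm hm' => ?_⟩
  rw [List.reverse_append] at hm hm'
  by_cases hs : s < w.length
  · rw [List.getElem?_append_left (by simpa using hs)] at hm
    rw [List.getElem?_append_left (by simpa using hw ▸ hs)] at hm'
    refine h.2 s m m' ?_ ?_
    · rwa [List.reverse_append, List.getElem?_append_left (by simpa using hs)]
    · rwa [List.reverse_append, List.getElem?_append_left (by simpa using hw ▸ hs)]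
  · rw [List.getElem?_append_right (by simpa using hs), List.length_reverse] at hm
    rw [List.getElem?_append_right (by simpa [← hw] using hs), List.length_reverse] at hm'
    rw [← hw, hm] at hm'
    exact .inl (Option.some.inj hm')

end Delay

/-! ### Histories that follow a decision structure -/

namespace DecisionStructure

variable {ι : Type*} {A : ι → Type*} {D V V' : Type*}

/-- The history that follows `S` from the node `v` along a word of directions. -/
def historyFrom (S : DecisionStructure A D V) : V → List D → List (Move A D)
  | _, [] => []
  | v, d :: w => (S.act v, d) :: historyFrom S (S.next v d) w

theorem historyFrom_append (S : DecisionStructure A D V) (v : V) (u w : List D) :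
    S.historyFrom v (u ++ w) = S.historyFrom v u ++ S.historyFrom (u.foldl S.next v) w := by
  induction u generalizing v with
  | nil => rfl
  | cons d u ih => simp [historyFrom, ih]

theorem map_snd_historyFrom (S : DecisionStructure A D V) (v : V) (w : List D) :
    (S.historyFrom v w).map Prod.snd = w := by
  induction w generalizing v with
  | nil => rfl
  | cons d w ih => simp [historyFrom, ih]

theorem length_historyFrom (S : DecisionStructure A D V) (v : V) (w : List D) :
    (S.historyFrom v w).length = w.length := by
  conv_rhs => rw [← S.map_snd_historyFrom v w, List.length_map]

theorem historyFrom_congr (S : DecisionStructure A D V) (S' : DecisionStructure A D V') {v : V}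
    {v' : V'} {w : List D}
    (h : ∀ u : List D, u.length < w.length → S.act (u.foldl S.next v) = S'.act (u.foldl S'.next v')) :
    S.historyFrom v w = S'.historyFrom v' w := by
  induction w using List.reverseRecOn with
  | nil => rfl
  | append_singleton w d ih =>
    rw [historyFrom_append, historyFrom_append,
      ih fun u hu => h u (by simpa using Nat.lt_succ_of_lt hu)]
    simp [historyFrom, h w (by simp)]

/-- The history that follows `S` along a word of directions. -/
def history (S : DecisionStructure A D V) (w : List D) : List (Move A D) := S.historyFrom S.init w

theorem history_concat (S : DecisionStructure A D V) (w : List D) (d : D) :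
    S.history (w ++ [d]) = S.history w ++ [(S.act (S.pathNode w), d)] :=
  S.historyFrom_append _ _ _

theorem node_history (S : DecisionStructure A D V) (w : List D) :
    S.node (S.history w) = S.pathNode w := by
  rw [node, history, map_snd_historyFrom]

theorem pathNode_append (S : DecisionStructure A D V) (u w : List D) :
    S.pathNode (u ++ w) = w.foldl S.next (S.pathNode u) :=
  List.foldl_append

theorem follows_nil (S : DecisionStructure A D V) : S.Follows [] := by
  intro σ α h
  simp at h

theorem follows_concat_iff (S : DecisionStructure A D V) (τ : List (Move A D)) (α : Move A D) :
    S.Follows (τ ++ [α]) ↔ S.Follows τ ∧ α.1 = S.act (S.node τ) := by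
  constructor
  · exact fun h => ⟨fun σ β hσ => h σ β (hσ.trans (List.prefix_append _ _)),
      h τ α (List.prefix_refl _)⟩
  · rintro ⟨h, hα⟩ σ β hσ
    rcases List.prefix_concat_iff.1 hσ with heq | hσ
    · obtain ⟨rfl, hβ⟩ := List.append_inj' heq rfl
      rw [List.cons.inj hβ |>.1]
      exact hα
    · exact h σ β hσ

/-- This allows histories that follow `S` to be replaced by words of directions. -/
theorem follows_iff (S : DecisionStructure A D V) (τ : List (Move A D)) :
    S.Follows τ ↔ τ = S.history (τ.map Prod.snd) := by
  induction τ using List.reverseRecOn with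
  | nil => exact ⟨fun _ => rfl, fun _ => S.follows_nil⟩
  | append_singleton τ α ih =>
    rw [follows_concat_iff, ih, List.map_append, List.map_singleton, history_concat]
    constructor
    · rintro ⟨h, hα⟩
      rw [← h, show S.pathNode (τ.map Prod.snd) = S.node τ from rfl, ← hα]
    · intro h
      obtain ⟨h1, h2⟩ := List.append_inj' h rfl
      exact ⟨h1, congrArg Prod.fst (List.cons.inj h2).1⟩

theorem follows_history (S : DecisionStructure A D V) (w : List D) : S.Follows (S.history w) := by
  rw [follows_iff]
  exact congrArg S.history (S.map_snd_historyFrom _ w).symm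

theorem Follows.eq_history {S : DecisionStructure A D V} {τ : List (Move A D)}
    (h : S.Follows τ) : τ = S.history (τ.map Prod.snd) :=
  (S.follows_iff τ).1 h

end DecisionStructure

/-! ### Unfolding a winning strategy into a tree witness -/

namespace DecisionStructure

variable {ι : Type*} {A : ι → Type*} {D V Q : Type*} {B QM : ι → Type*}

/-- The tree unfolding of a decision structure. -/
def unfolding (S : DecisionStructure A D V) : DecisionStructure A D (List D) where
  init := []
  next w d := w ++ [d]
  act w := S.act (S.pathNode w)

theorem pathNode_unfolding (S : DecisionStructure A D V) (w : List D) :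
    S.unfolding.pathNode w = w := by
  induction w using List.reverseRecOn with
  | nil => rfl
  | append_singleton w d ih =>
    rw [pathNode_append, ih]
    rfl

theorem isTree_unfolding (S : DecisionStructure A D V) : S.unfolding.IsTree := by
  have : S.unfolding.pathNode = id := funext S.pathNode_unfolding
  rw [IsTree, this]
  exact Function.bijective_id

theorem node_unfolding (S : DecisionStructure A D V) (τ : List (Move A D)) :
    S.unfolding.node τ = τ.map Prod.snd :=
  S.pathNode_unfolding _

theorem act_node_unfolding (S : DecisionStructure A D V) (τ : List (Move A D)) :
    S.unfolding.act (S.unfolding.node τ) = S.act (S.node τ) := by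
  rw [node_unfolding]
  rfl

theorem follows_unfolding (S : DecisionStructure A D V) (τ : List (Move A D)) :
    S.unfolding.Follows τ ↔ S.Follows τ := by
  simp only [Follows, act_node_unfolding]

/-- A run may depend on the whole history, whereas labels depend on the node only. In the unfolding
the node determines the history that follows `S`, so the run becomes a labelling. -/
theorem isWitness_unfolding {S : DecisionStructure A D V} {G : DistGame A D B QM}
    {W : TreeAutomaton A D Q} (hS : S.IsStrategy G) {r : List (Move A D) → Q}
    (hr : W.IsRun S r) (hacc : W.IsAccepting S r) :
    S.unfolding.IsWitness G W
      fun w => (fun i => (G i).stateAfter (S.history w), r (S.history w)) := by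
  have hnode : ∀ τ, S.Follows τ → S.history (S.unfolding.node τ) = τ := fun τ h => by
    rw [node_unfolding, ← h.eq_history]
  refine ⟨⟨?_, fun τ hτ i => ?_, hr.1, fun τ hτ => ?_⟩, fun π hπ => ?_⟩
  · rintro i _ _ ⟨τ, τ', h, h', hi, rfl, rfl⟩
    rw [follows_unfolding] at h h'
    rw [act_node_unfolding, act_node_unfolding]
    exact hS i _ _ ⟨τ, τ', h, h', hi, rfl, rfl⟩
  · rw [follows_unfolding] at hτ
    simp only [hnode τ hτ]
  · rw [follows_unfolding] at hτ
    simp only [act_node_unfolding]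
    convert! hr.2 τ hτ using 4
    · rw [hnode τ hτ]
    · rw [hnode _ ((S.follows_concat_iff _ _).2 ⟨hτ, rfl⟩)]
  · simp only [follows_unfolding] at hπ
    simpa only [fun n => hnode _ (hπ n)] using hacc π hπ

end DecisionStructure

/-! ### Finite-state winning strategies -/

namespace DecisionStructure

variable {ι : Type*} {A : ι → Type*} {D V Q : Type*} {B QM : ι → Type*}

theorem list_map_range_add {α : Type*} (u : List α) (δ f : ℕ → α)
    (hu : ∀ n (h : n < u.length), f n = u[n]) (hδ : ∀ n, f (u.length + n) = δ n) (n : ℕ) :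
    (List.range (u.length + n)).map f = u ++ (List.range n).map δ := by
  rw [List.range_add, List.map_append, List.map_map]
  congr 1
  · exact List.ext_getElem (by simp) fun n h1 h2 => by simpa using hu n h2
  · exact List.map_congr_left fun n _ => hδ n

/-- Along no path through the tree of directions, starting at any node, the least priority seen
infinitely often is odd. -/
theorem not_exists_odd_path {S : DecisionStructure A D V} {W : TreeAutomaton A D Q}
    {r : List (Move A D) → Q} (hacc : W.IsAccepting S r) {p : ℕ} (hp : Odd p) :
    ¬ ∃ f : ℕ → List D, (∀ n, ∃ d, f (n + 1) = f n ++ [d]) ∧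
      (∀ n, p ≤ W.priority (r (S.history (f n)))) ∧
      ∃ᶠ n in Filter.atTop, W.priority (r (S.history (f n))) = p := by
  rintro ⟨f, hf, hle, hfreq⟩
  choose δ hδ using hf
  have hfδ : ∀ n, f n = f 0 ++ (List.range n).map δ := by
    intro n
    induction n with
    | zero => simp
    | succ n ih => rw [hδ, List.range_succ, List.map_append, ← List.append_assoc, ← ih]; rfl
  -- Prefixing the word `f 0` turns the path into a play from the root; the finite prefix does not
  -- affect the priorities seen infinitely often.
  let e : ℕ → D := fun n => if h : n < (f 0).length then (f 0)[n] else δ (n - (f 0).length)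
  let π : ℕ → Move A D := fun n => (S.act (S.pathNode ((List.range n).map e)), e n)
  have hπ : ∀ n, (List.range n).map π = S.history ((List.range n).map e) := by
    intro n
    induction n with
    | zero => rfl
    | succ n ih =>
      rw [List.range_succ, List.map_append, List.map_append, List.map_singleton,
        List.map_singleton, history_concat, ih]
  have he : ∀ n, (List.range ((f 0).length + n)).map e = f n := by
    intro n
    rw [hfδ n]
    exact list_map_range_add _ _ _ (fun n h => by simp [e, h]) (fun n => by simp [e]) n
  obtain ⟨q, hq, hqmem, hqleast⟩ := hacc π fun n => by rw [hπ]; exact S.follows_history _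
  simp only [hπ] at hqmem hqleast
  have hval : ∀ n, (f 0).length ≤ n →
      S.history ((List.range n).map e) = S.history (f (n - (f 0).length)) := by
    intro n hn
    rw [← he, Nat.add_sub_cancel' hn]
  have hpq : p ≤ q := by
    obtain ⟨n, hn, h⟩ := Filter.frequently_atTop.1 hqmem (f 0).length
    rw [hval n hn] at h
    exact h ▸ hle _
  have hqp : q ≤ p := by
    refine hqleast (Filter.frequently_atTop.2 fun a => ?_)
    obtain ⟨n, hn, h⟩ := Filter.frequently_atTop.1 hfreq a
    exact ⟨(f 0).length + n, by omega, by rw [he]; exact h⟩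
  rw [le_antisymm hpq hqp] at hp
  exact (Nat.not_even_iff_odd.2 hp) hq

/-- The finite data about the node of the tree of directions that the finite-state strategy
remembers: the state of the automaton, and the actions in the next `k` rounds. -/
def localType (S : DecisionStructure A D V) (r : List (Move A D) → Q) (k : ℕ) (u : List D) :
    Q × ({w : List D // w.length ≤ k} → ∀ i, A i) :=
  (r (S.history u), fun w => S.act (S.pathNode (u ++ w.1)))

/-- The strategy that plays, for a class of nodes of the tree of directions, like at its
representative. -/
def quotientStructure (S : DecisionStructure A D V) {C : Type*} (cls : List D → C)
    (rep : C → List D) : DecisionStructure A D C where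
  init := cls []
  next t d := cls (rep t ++ [d])
  act t := S.act (S.pathNode (rep t))

section Quotient

variable {S : DecisionStructure A D V} {C : Type*} {cls : List D → C} {rep : C → List D}

/-- Each jump stays within a class and so preserves the actions up to `k` rounds ahead; for `k`
rounds the jumps do not show. -/
theorem act_foldl_quotientStructure {k : ℕ}
    (hact : ∀ u u', cls u = cls u' → ∀ w : List D, w.length ≤ k →
      S.act (S.pathNode (u ++ w)) = S.act (S.pathNode (u' ++ w)))
    (hrep : ∀ x, cls (rep (cls x)) = cls x) (t : C) (w : List D) (hw : w.length ≤ k) :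
    (S.quotientStructure cls rep).act (w.foldl (S.quotientStructure cls rep).next t) =
      S.act (S.pathNode (rep t ++ w)) := by
  induction w generalizing t with
  | nil => simp [quotientStructure]
  | cons d w ih =>
    simp only [List.length_cons] at hw
    rw [List.foldl_cons, ih _ (by omega)]
    refine (hact _ _ (hrep _) w (by omega)).trans ?_
    simp

theorem historyFrom_quotientStructure {k : ℕ}
    (hact : ∀ u u', cls u = cls u' → ∀ w : List D, w.length ≤ k →
      S.act (S.pathNode (u ++ w)) = S.act (S.pathNode (u' ++ w)))
    (hrep : ∀ x, cls (rep (cls x)) = cls x) (t : C) (w : List D) (hw : w.length ≤ k) :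
    (S.quotientStructure cls rep).historyFrom t w =
      S.historyFrom (S.pathNode (rep t)) w :=
  historyFrom_congr _ _ fun u hu => by
    rw [act_foldl_quotientStructure hact hrep t u (by omega), pathNode_append]

theorem isStrategy_quotientStructure {k : ℕ} {lag : D → ι → Fin (k + 1)}
    (hS : S.IsStrategy (delayGame k lag))
    (hact : ∀ u u', cls u = cls u' → ∀ w : List D, w.length ≤ k →
      S.act (S.pathNode (u ++ w)) = S.act (S.pathNode (u' ++ w)))
    (hrep : ∀ x, cls (rep (cls x)) = cls x) :
    (S.quotientStructure cls rep).IsStrategy (delayGame k lag) := by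
  rintro i _ _ ⟨τ, τ', hτ, hτ', hi, rfl, rfl⟩
  rw [delayGame_indist_iff] at hi
  set F := S.quotientStructure cls rep with hF
  -- Cut off the last `min k τ.length` rounds: they are played as `S` plays below the representative
  -- of the node where the remaining stem ends.
  have hsplit : ∀ τ, F.Follows τ → ∃ w : List D, w.length ≤ k ∧
      w.length = τ.length - (τ.length - k) ∧
      τ = τ.take (τ.length - k) ++
        S.historyFrom (S.pathNode (rep (F.node (τ.take (τ.length - k))))) w ∧
      F.act (F.node τ) =
        S.act (S.pathNode (rep (F.node (τ.take (τ.length - k))) ++ w)) := by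
    intro τ hτ
    set u := τ.map Prod.snd with hu
    have hlen : u.length = τ.length := by simp [hu]
    set n := τ.length - k
    have hw : (u.drop n).length ≤ k := by simp only [List.length_drop]; omega
    have hτu : τ = F.history (u.take n) ++ F.historyFrom (F.pathNode (u.take n)) (u.drop n) := by
      conv_lhs => rw [hτ.eq_history, ← hu, ← List.take_append_drop n u]
      exact F.historyFrom_append _ _ _
    have htake : τ.take n = F.history (u.take n) := by
      have h1 : (F.history (u.take n)).length = n := by
        rw [history, length_historyFrom, List.length_take]
        omega
      conv_lhs => rw [hτu]
      exact List.take_left' h1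
    have hnode : F.node (τ.take n) = F.pathNode (u.take n) := by rw [htake, node_history]
    refine ⟨u.drop n, hw, by rw [List.length_drop, hlen], ?_, ?_⟩
    · rw [hnode, ← historyFrom_quotientStructure hact hrep _ _ hw, htake]
      exact hτu
    · rw [hnode, ← act_foldl_quotientStructure hact hrep _ _ hw, ← hF, ← pathNode_append,
        List.take_append_drop]
      rfl
  obtain ⟨w, hw, hwl, hwτ, hwa⟩ := hsplit τ hτ
  obtain ⟨w', hw', hwl', hwτ', hwa'⟩ := hsplit τ' hτ'
  have hlen : w.length = w'.length := by rw [hwl, hwl', hi.1]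
  -- Both histories have the same stem, hence the same representative.
  rw [← hi.take_eq] at hwτ' hwa'
  rw [hwa, hwa']
  clear hwl hwl' hwa hwa'
  generalize τ.take (τ.length - k) = σ at hwτ hwτ' ⊢
  rw [hwτ, hwτ'] at hi
  -- The stem `σ` need not follow `S`; it is exchanged for the history of `S` that leads to the
  -- representative.
  refine hS i _ _ ⟨_, _, S.follows_history _, S.follows_history _, ?_, S.node_history _,
    S.node_history _⟩
  rw [delayGame_indist_iff, history, history, historyFrom_append, historyFrom_append]
  exact hi.replace_stem (by rw [length_historyFrom, length_historyFrom, hlen]) _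

end Quotient

theorem exists_finite_isWinning [Finite ι] [∀ i, Finite (A i)] [Finite D] [Finite Q] {k : ℕ}
    {lag : D → ι → Fin (k + 1)} {S : DecisionStructure A D V} {W : TreeAutomaton A D Q}
    (hS : S.IsWinning (delayGame k lag) W) :
    ∃ (V' : Type) (_ : Finite V') (S' : DecisionStructure A D V'),
      S'.IsWinning (delayGame k lag) W := by
  obtain ⟨hstr, r, hr, hacc⟩ := hS
  have : Finite {w : List D // w.length ≤ k} := (List.finite_length_le D k).to_subtype
  -- Coding local types by numbers places the set of nodes in `Type`.
  obtain ⟨N, ⟨e⟩⟩ := Finite.exists_equiv_fin (Q × ({w : List D // w.length ≤ k} → ∀ i, A i))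
  obtain ⟨m, hm⟩ := (Set.finite_range W.priority).bddAbove
  obtain ⟨rep, hrep, hpar⟩ := exists_representatives (X := List D) (fun u u' => ∃ d, u' = u ++ [d])
    (fun u => W.priority (r (S.history u))) m (fun u => hm ⟨_, rfl⟩)
    (fun u => e (S.localType r k u)) fun p hp => not_exists_odd_path hacc hp
  set cls : List D → Fin N := fun u => e (S.localType r k u) with hcls
  have htype : ∀ u u', cls u = cls u' → S.localType r k u = S.localType r k u' :=
    fun u u' h => e.injective h
  have hq : ∀ u u', cls u = cls u' → r (S.history u) = r (S.history u') :=
    fun u u' h => congrArg Prod.fst (htype u u' h)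
  have hact : ∀ u u', cls u = cls u' → ∀ w : List D, w.length ≤ k →
      S.act (S.pathNode (u ++ w)) = S.act (S.pathNode (u' ++ w)) :=
    fun u u' h w hw => congrFun (congrArg Prod.snd (htype u u' h)) ⟨w, hw⟩
  have hstep : ∀ τ α, (S.quotientStructure cls rep).node (τ ++ [α]) =
      cls (rep ((S.quotientStructure cls rep).node τ) ++ [α.2]) := by
    intro τ α
    simp [node, pathNode_append, quotientStructure]
  refine ⟨Fin N, inferInstance, S.quotientStructure cls rep,
    isStrategy_quotientStructure hstr hact hrep,
    fun τ => r (S.history (rep ((S.quotientStructure cls rep).node τ))), ⟨?_, ?_⟩, ?_⟩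
  · exact (hq _ _ (hrep [])).trans hr.1
  · intro τ _
    have := hr.2 _ (S.follows_history (rep ((S.quotientStructure cls rep).node τ)))
    convert! this using 4
    · rw [node_history]
      rfl
    · beta_reduce
      rw [hstep, hq _ _ (hrep _), history_concat, node_history]
  -- The representatives visited along a play form a path with jumps.
  · intro π _
    refine hpar (fun n => rep ((S.quotientStructure cls rep).node ((List.range n).map π)))
      fun n => ⟨_, ⟨(π n).2, rfl⟩, ?_⟩
    rw [List.range_succ, List.map_append, List.map_singleton, hstep]

end DecisionStructure

/-! ### Distributed states of tree witnesses -/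

namespace DecisionStructure

variable {ι : Type*} {A : ι → Type*} {D V Q : Type*} {k : ℕ} {lag : D → ι → Fin (k + 1)}

theorem IsTree.eq_of_uniform {S : DecisionStructure A D V} (hT : S.IsTree) {i : ι}
    {u u' : List D} (h : S.Uniform (delayGame k lag) i (S.pathNode u) (S.pathNode u')) :
    (u.length, u.take (u.length - k)) = (u'.length, u'.take (u'.length - k)) := by
  obtain ⟨τ, τ', -, -, hi, h, h'⟩ := h
  rw [delayGame_indist_iff] at hi
  obtain rfl := hT.1 h
  obtain rfl := hT.1 h'
  have := congrArg (List.map Prod.snd) hi.take_eq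
  rw [List.map_take, List.map_take] at this
  simpa [hi.1] using this

theorem IsDState.exists_stem {S : DecisionStructure A D V} (hT : S.IsTree) {K : Set V}
    (hK : S.IsDState (delayGame k lag) K) :
    ∃ (σ : List D) (n : ℕ), n ≤ k ∧ ∀ x ∈ K, ∃ w : List D, w.length = n ∧
      S.pathNode (σ ++ w) = x := by
  obtain ⟨v, rfl⟩ := hK
  obtain ⟨u, rfl⟩ := hT.2 v
  refine ⟨u.take (u.length - k), u.length - (u.length - k), by omega, fun x hx => ?_⟩
  -- Depth and the word without its last `k` directions are invariant under each `≈ⁱ`, hence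
  -- constant on a component.
  have key : ∀ v x, Relation.EqvGen (fun x y => ∃ i, S.Uniform (delayGame k lag) i x y) v x →
      ∀ u u', S.pathNode u = v → S.pathNode u' = x →
        (u.length, u.take (u.length - k)) = (u'.length, u'.take (u'.length - k)) := by
    intro v x h
    induction h with
    | rel v x h =>
      rintro u u' rfl rfl
      exact hT.eq_of_uniform h.choose_spec
    | refl v =>
      rintro u u' rfl h
      rw [hT.1 h]
    | symm v x _ ih => exact fun u u' h h' => (ih u' u h' h).symm
    | trans v x y _ _ ih ih' =>
      intro u u' h h'
      obtain ⟨u'', hu''⟩ := hT.2 x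
      exact (ih u u'' h hu'').trans (ih' u'' u' hu'' h')
  obtain ⟨u', rfl⟩ := hT.2 x
  obtain ⟨h1, h2⟩ := Prod.mk.inj (key _ _ hx u u' rfl rfl)
  refine ⟨u'.drop (u'.length - k), by rw [List.length_drop, h1], ?_⟩
  rw [h2, List.take_append_drop]

theorem ncard_length_eq (D : Type*) [Finite D] (n : ℕ) :
    {w : List D | w.length = n}.ncard = Nat.card D ^ n := by
  have := Fintype.ofFinite D
  rw [← Nat.card_coe_set_eq, Nat.card_eq_fintype_card (α := D), ← card_vector]
  exact Nat.card_eq_fintype_card (α := List.Vector D n)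

theorem IsDState.finite_and_ncard_le [Finite ι] [∀ i, Finite (A i)] [Finite D] [Nonempty D]
    {S : DecisionStructure A D V} (hT : S.IsTree) {K : Set V}
    (hK : S.IsDState (delayGame k lag) K) :
    K.Finite ∧ K.ncard ≤ Nat.card (Move A D) ^ k := by
  obtain ⟨σ, n, hn, hσ⟩ := hK.exists_stem hT
  have hfin : {w : List D | w.length = n}.Finite := List.finite_length_eq D n
  have hsub : K ⊆ (fun w => S.pathNode (σ ++ w)) '' {w : List D | w.length = n} := hσ
  refine ⟨(hfin.image _).subset hsub, ?_⟩
  have : Nonempty (∀ i, A i) := ⟨S.act S.init⟩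
  calc K.ncard ≤ _ := Set.ncard_le_ncard hsub (hfin.image _)
    _ ≤ {w : List D | w.length = n}.ncard := Set.ncard_image_le hfin
    _ = Nat.card D ^ n := ncard_length_eq D n
    _ ≤ Nat.card D ^ k := Nat.pow_le_pow_right Nat.card_pos hn
    _ ≤ Nat.card (Move A D) ^ k := Nat.pow_le_pow_left (by
        rw [Nat.card_prod]
        exact Nat.le_mul_of_pos_left _ Nat.card_pos) k

/-- All nodes of a d-state have the same depth, so the clause on transitions in `DStateIso` holds
vacuously. -/
theorem IsDState.next_ne {S : DecisionStructure A D V} (hT : S.IsTree) {K : Set V}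
    (hK : S.IsDState (delayGame k lag) K) {x y : V} (hx : x ∈ K) (hy : y ∈ K) (d : D) :
    S.next x d ≠ y := by
  obtain ⟨σ, n, -, hσ⟩ := hK.exists_stem hT
  obtain ⟨w, hw, rfl⟩ := hσ x hx
  obtain ⟨w', hw', rfl⟩ := hσ y hy
  intro h
  have h' : S.pathNode (σ ++ w ++ [d]) = S.pathNode (σ ++ w') := by
    rw [pathNode_append S (σ ++ w)]
    exact h
  have := congrArg List.length (hT.1 h')
  simp only [List.length_append, List.length_singleton] at this
  omega

/-- The words of length at most `k` that lead from the end of `σ` into `K`. -/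
def wordsInto (S : DecisionStructure A D V) (k : ℕ) (σ : List D) (K : Set V) :
    Set {w : List D // w.length ≤ k} :=
  {w | S.pathNode (σ ++ w.1) ∈ K}

theorem bijective_wordsInto {S : DecisionStructure A D V} (hT : S.IsTree) {σ : List D} {K : Set V}
    (hσ : ∀ x ∈ K, ∃ w : List D, w.length ≤ k ∧ S.pathNode (σ ++ w) = x) :
    Function.Bijective fun w : S.wordsInto k σ K => (⟨S.pathNode (σ ++ w.1.1), w.2⟩ : K) := by
  constructor
  · intro w w' h
    exact Subtype.ext (Subtype.ext (List.append_cancel_left (hT.1 (congrArg Subtype.val h))))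
  · rintro ⟨x, hx⟩
    obtain ⟨w, hw, rfl⟩ := hσ x hx
    exact ⟨⟨⟨w, hw⟩, hx⟩, rfl⟩

/-- The isomorphism keeps the word below the stem and exchanges `σ` for `σ'`. -/
theorem dStateIso_of_wordsInto {S : DecisionStructure A D V} (hT : S.IsTree)
    {ρ : V → (∀ _ : ι, Fin k → Option (Move A D)) × Q} {K L : Set V}
    (hK : S.IsDState (delayGame k lag) K) (hL : S.IsDState (delayGame k lag) L) {σ σ' : List D}
    (hσ : ∀ x ∈ K, ∃ w : List D, w.length ≤ k ∧ S.pathNode (σ ++ w) = x)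
    (hσ' : ∀ x ∈ L, ∃ w : List D, w.length ≤ k ∧ S.pathNode (σ' ++ w) = x)
    (hwords : S.wordsInto k σ K = S.wordsInto k σ' L)
    (hρ : ∀ w : List D, w.length ≤ k → ρ (S.pathNode (σ ++ w)) = ρ (S.pathNode (σ' ++ w)))
    (hunif : ∀ i (w w' : List D), w.length ≤ k → w'.length ≤ k →
      (S.Uniform (delayGame k lag) i (S.pathNode (σ ++ w)) (S.pathNode (σ ++ w')) ↔
        S.Uniform (delayGame k lag) i (S.pathNode (σ' ++ w)) (S.pathNode (σ' ++ w')))) :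
    S.DStateIso (delayGame k lag) ρ K L := by
  let eK := Equiv.ofBijective _ (bijective_wordsInto hT hσ)
  let eL := Equiv.ofBijective _ (bijective_wordsInto hT hσ')
  let e : K ≃ L := eK.symm.trans ((Equiv.setCongr hwords).trans eL)
  have he : ∀ w, e (eK w) = eL (Equiv.setCongr hwords w) := fun w => by simp [e]
  refine ⟨e, fun x y d => ?_, fun i x y => ?_, fun x => ?_⟩
  · exact iff_of_false (hK.next_ne hT x.2 y.2 d) (hL.next_ne hT (e x).2 (e y).2 d)
  · obtain ⟨w, rfl⟩ := eK.surjective x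
    obtain ⟨w', rfl⟩ := eK.surjective y
    rw [he, he]
    exact hunif i _ _ w.1.2 w'.1.2
  · obtain ⟨w, rfl⟩ := eK.surjective x
    rw [he]
    exact (hρ _ w.1.2).symm

theorem IsTree.finiteIndex [Finite ι] [∀ i, Finite (A i)] [Finite D] [Finite Q]
    {S : DecisionStructure A D V} (hT : S.IsTree)
    (ρ : V → (∀ _ : ι, Fin k → Option (Move A D)) × Q) :
    S.FiniteIndex (delayGame k lag) ρ := by
  classical
  have : Finite {w : List D // w.length ≤ k} := (List.finite_length_le D k).to_subtype
  have hstem : ∀ K, ∃ σ : List D, S.IsDState (delayGame k lag) K →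
      ∀ x ∈ K, ∃ w : List D, w.length ≤ k ∧ S.pathNode (σ ++ w) = x := by
    intro K
    by_cases hK : S.IsDState (delayGame k lag) K
    · obtain ⟨σ, n, hn, hσ⟩ := hK.exists_stem hT
      exact ⟨σ, fun _ x hx => (hσ x hx).imp fun w hw => ⟨hw.1.trans_le hn, hw.2⟩⟩
    · exact ⟨[], fun h => absurd h hK⟩
  choose stem hstem using hstem
  -- These data range over a finite type and determine a d-state up to isomorphism; `F` contains one
  -- d-state for each value attained.
  let data : Set V → Set {w : List D // w.length ≤ k} ×
      ({w : List D // w.length ≤ k} → (∀ _ : ι, Fin k → Option (Move A D)) × Q) ×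
      (ι → {w : List D // w.length ≤ k} → {w : List D // w.length ≤ k} → Prop) := fun K =>
    (S.wordsInto k (stem K) K, fun w => ρ (S.pathNode (stem K ++ w.1)), fun i w w' =>
      S.Uniform (delayGame k lag) i (S.pathNode (stem K ++ w.1)) (S.pathNode (stem K ++ w'.1)))
  obtain ⟨F, hFsub, hF⟩ := Set.exists_subset_bijOn {K | S.IsDState (delayGame k lag) K} data
  refine ⟨F, Set.Finite.of_finite_image (f := data) (Set.toFinite _) hF.injOn,
    fun L hL => hFsub hL, fun K hK => ?_⟩
  obtain ⟨L, hL, hdata⟩ := hF.surjOn ⟨K, hK, rfl⟩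
  refine ⟨L, hL, ?_⟩
  obtain ⟨h1, h2⟩ := Prod.mk.inj hdata.symm
  obtain ⟨h2, h3⟩ := Prod.mk.inj h2
  exact dStateIso_of_wordsInto hT hK (hFsub hL) (hstem K hK) (hstem L (hFsub hL)) h1
    (fun w hw => congrFun h2 ⟨w, hw⟩)
    fun i w w' hw hw' => iff_of_eq (congrFun (congrFun (congrFun h3 i) ⟨w, hw⟩) ⟨w', hw'⟩)

end DecisionStructure

theorem mainTheorem7 (k : ℕ) (A : Fin 2 → Type*) [∀ i, Finite (A i)]
    (D : Type*) [Finite D] [Nonempty D] (lag : D → Fin 2 → Fin (k + 1))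
    (Q : Type*) [Finite Q] (W : TreeAutomaton A D Q) :
    -- d-states of tree witnesses are bounded, and there are finitely many up to isomorphism
    (∀ (V : Type*) (S : DecisionStructure A D V)
        (ρ : V → (Fin 2 → Fin k → Option (Move A D)) × Q),
      S.IsTree → S.IsWitness (delayGame k lag) W ρ →
        (∀ K, S.IsDState (delayGame (A := A) k lag) K →
          K.Finite ∧ K.ncard ≤ Nat.card (Move A D) ^ k) ∧
        S.FiniteIndex (delayGame k lag) ρ) ∧
    -- if there is a winning strategy, then there are a tree witness and a finite-state
    -- winning strategy
    (∀ (V : Type*) (S : DecisionStructure A D V), S.IsWinning (delayGame k lag) W →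
      (∃ (T : DecisionStructure A D (List D))
          (ρ : List D → (Fin 2 → Fin k → Option (Move A D)) × Q),
        T.IsTree ∧ T.IsWitness (delayGame k lag) W ρ) ∧
      ∃ (V' : Type) (_ : Finite V') (S' : DecisionStructure A D V'),
        S'.IsWinning (delayGame k lag) W) := by
  refine ⟨fun V S ρ hT _ => ⟨fun K hK => hK.finite_and_ncard_le hT, hT.finiteIndex ρ⟩,
    fun V S hS => ⟨?_, DecisionStructure.exists_finite_isWinning hS⟩⟩
  obtain ⟨hstr, r, hr, hacc⟩ := hS
  exact ⟨_, _, S.isTree_unfolding, DecisionStructure.isWitness_unfolding hstr hr hacc⟩
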